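/- Let $K$ be a field (for instance $K=\mathbf Q$) and let $n\ge 0$ be an integer. The Fomin–Kirillov algebra $\mathcal E_n$ is the associative unital $K$-algebra with generators $x_{ij}$ for distinct $i,j\in[n]=\{1,\dots,n\}$ and relations $x_{ij}=-x_{ji}$ and $x_{ij}^2=0$ for distinct $i,j$; $x_{ij}x_{kl}=x_{kl}x_{ij}$ for distinct $i,j,k,l$; and $x_{ij}x_{jk}+x_{jk}x_{ki}+x_{ki}x_{ij}=0$ for distinct $i,j,k$. For a simple graph $G$ with vertex set $[n]$, let $\mathcal E_G\subseteq\mathcal E_n$ be the subalgebra generated by the $x_{ij}$ with $\overline{ij}$ an edge of $G$, and let $\mathcal E_G^{ab}$ be its commutative quotient, that is, the quotient of $\mathcal E_G$ by the two-sided ideal generated by all $x_{ij}x_{ik}-x_{ik}x_{ij}$ with $\overline{ij}$, $\overline{ik}$ edges of $G$. For $d\ge 0$ let $(\mathcal E_G^{ab})_d$ be the $K$-span of the images of all products of $d$ generators $x_{ij}$, $\overline{ij}\in G$. Then for every simple graph $G$ with vertex set $[n]$, $\mathcal E_G^{ab}=\bigoplus_{d\ge0}(\mathcal E_G^{ab})_d$,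 each $(\mathcal E_G^{ab})_d$ is finite-dimensional, and the Hilbert series $\mathcal H_G^{ab}(t)=\sum_{d\ge0}\dim_K(\mathcal E_G^{ab})_d\,t^d$ is $$\mathcal H_G^{ab}(t)=(-t)^n\,\chi_G(-t^{-1}),$$ where $\chi_G$ is the chromatic polynomial of $G$, the polynomial whose value at each natural number $q$ is the number of proper colourings of $G$ with $q$ colours. The identity is read in the field of formal Laurent series $\mathbf Q((t))$. In particular, for the complete graph $K_n$ on $[n]$, for which $\mathcal E_{K_n}=\mathcal E_n$, the Hilbert series of $\mathcal E_n^{ab}$ is $(1+t)(1+2t)\cdots(1+(n-1)t)$. -/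

import Mathlib

/-- The polynomial in `ℤ[X]` whose value at every natural number `q` is the number of proper
colourings of `G` with `q` colours exists and is unique. -/
theorem SimpleGraph.existsUnique_chromaticPolynomial {V : Type*} [Finite V]
    (G : SimpleGraph V) :
    ∃! χ : Polynomial ℤ,
      ∀ q : ℕ, χ.eval (q : ℤ) = (Nat.card (G.Coloring (Fin q)) : ℤ) := by
  classical
  have := Fintype.ofFinite V
  have : Finite (Setoid V) :=
    Finite.of_injective (fun s : Setoid V => fun a b => s a b) fun s t h => by
      ext a b; exact iff_of_eq (congrFun (congrFun h a) b)
  have := Fintype.ofFinite (Setoid V)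
  -- group the proper colourings by the partition of `V` into colour classes
  let I : Type _ := {s : Setoid V // ∀ a b, G.Adj a b → ¬ s a b}
  have hev : ∀ q : ℕ, (∑ s : I, descPochhammer ℤ (Nat.card (Quotient s.1))).eval (q : ℤ) =
      (Nat.card (G.Coloring (Fin q)) : ℤ) := by
    intro q
    have e : G.Coloring (Fin q) ≃ Σ s : I, (Quotient s.1 ↪ Fin q) :=
      { toFun := fun f => ⟨⟨Setoid.ker f, fun a b h h' => f.valid h h'⟩,
          ⟨Quotient.lift f fun _ _ h => h, fun x y => by
            induction x using Quotient.inductionOn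
            induction y using Quotient.inductionOn
            intro h
            exact Quotient.sound h⟩⟩
        invFun := fun p => SimpleGraph.Coloring.mk (fun v => p.2 (Quotient.mk p.1.1 v))
          fun {a b} h h' => p.1.2 a b h (Quotient.exact (p.2.injective h'))
        left_inv := fun f => by ext v; rfl
        right_inv := fun p => by
          obtain ⟨⟨s, hs⟩, g⟩ := p
          have hk : (Setoid.ker fun v => g (Quotient.mk s v)) = s := by
            ext a b
            exact ⟨fun h => Quotient.exact (g.injective h),
              fun h => congrArg g (Quotient.sound h)⟩
          refine Sigma.ext (Subtype.ext hk) ?_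
          have key : ∀ (t : Setoid V) (ht : t = s) (k : Quotient t ↪ Fin q),
              (∀ v, k (Quotient.mk t v) = g (Quotient.mk s v)) → k ≍ g := by
            rintro t rfl k h
            refine heq_of_eq ?_
            ext x
            induction x using Quotient.inductionOn
            rw [h]
          exact key _ hk _ fun v => rfl }
    rw [Nat.card_congr e, Nat.card_sigma, Polynomial.eval_finsetSum]
    push_cast
    refine Finset.sum_congr rfl fun s _ => ?_
    rw [descPochhammer_eval_eq_descFactorial, Nat.card_eq_fintype_card,
      Nat.card_eq_fintype_card, Fintype.card_embedding_eq, Fintype.card_fin]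
  refine ⟨_, hev, fun χ' h' => ?_⟩
  refine Polynomial.eq_of_infinite_eval_eq _ _ ?_
  refine (Set.infinite_range_of_injective (Nat.cast_injective (R := ℤ))).mono ?_
  rintro _ ⟨q, rfl⟩
  exact (h' q).trans (hev q).symm

/-- The chromatic polynomial of a finite graph `G`: the polynomial `χ` such that `χ(q)` is the
number of proper colourings of `G` with `q` colours, for all natural numbers `q`. -/
noncomputable def SimpleGraph.chromaticPolynomial {V : Type*} [Finite V]
    (G : SimpleGraph V) : Polynomial ℤ :=
  G.existsUnique_chromaticPolynomial.choose

theorem SimpleGraph.chromaticPolynomial_eval {V : Type*} [Finite V] (G : SimpleGraph V)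
    (q : ℕ) :
    G.chromaticPolynomial.eval (q : ℤ) = (Nat.card (G.Coloring (Fin q)) : ℤ) :=
  G.existsUnique_chromaticPolynomial.choose_spec.1 q

namespace FominKirillov

/-- The index set of the generators `x_{ij}`: ordered pairs of distinct elements of `[n]`. -/
abbrev Gen (n : ℕ) : Type := {p : Fin n × Fin n // p.1 ≠ p.2}

/-- The free generator `x_{ij}`. -/
noncomputable def freeX (K : Type*) [Field K] {n : ℕ} {i j : Fin n} (h : i ≠ j) :
    FreeAlgebra K (Gen n) :=
  FreeAlgebra.ι K ⟨(i, j), h⟩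

/-- The defining relations of the Fomin-Kirillov algebra `E_n`. -/
inductive Rel (K : Type*) [Field K] (n : ℕ) :
    FreeAlgebra K (Gen n) → FreeAlgebra K (Gen n) → Prop
  | antisymm (i j : Fin n) (h : i ≠ j) :
      Rel K n (freeX K h) (-freeX K h.symm)
  | sq (i j : Fin n) (h : i ≠ j) :
      Rel K n (freeX K h ^ 2) 0
  | comm (i j k l : Fin n) (hij : i ≠ j) (hik : i ≠ k) (hil : i ≠ l)
      (hjk : j ≠ k) (hjl : j ≠ l) (hkl : k ≠ l) :
      Rel K n (freeX K hij * freeX K hkl) (freeX K hkl * freeX K hij)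
  | cyclic (i j k : Fin n) (hij : i ≠ j) (hjk : j ≠ k) (hki : k ≠ i) :
      Rel K n (freeX K hij * freeX K hjk + freeX K hjk * freeX K hki
        + freeX K hki * freeX K hij) 0

/-- The Fomin-Kirillov algebra `E_n` over `K`. -/
abbrev Alg (K : Type*) [Field K] (n : ℕ) : Type _ := RingQuot (Rel K n)

/-- The generator `x_{ij}` of `E_n`. -/
noncomputable def x (K : Type*) [Field K] {n : ℕ} {i j : Fin n} (h : i ≠ j) : Alg K n :=
  RingQuot.mkAlgHom K (Rel K n) (freeX K h)

/-- The Fomin-Kirillov algebra `E_G` of a graph `G` on `[n]`: the subalgebra of `E_n` generated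
by the `x_{ij}` for the edges `ij` of `G`. -/
noncomputable def graphAlg (K : Type*) [Field K] {n : ℕ} (G : SimpleGraph (Fin n)) :
    Subalgebra K (Alg K n) :=
  Algebra.adjoin K {y | ∃ (i j : Fin n) (h : G.Adj i j), y = x K h.ne}

/-- The generator `x_{ij}` of `E_G`, for an edge `ij` of `G`. -/
noncomputable def edgeX (K : Type*) [Field K] {n : ℕ} {G : SimpleGraph (Fin n)} {i j : Fin n}
    (h : G.Adj i j) : graphAlg K G :=
  ⟨x K h.ne, Algebra.subset_adjoin ⟨i, j, h, rfl⟩⟩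

/-- The relations `x_{ij} x_{ik} = x_{ik} x_{ij}`, for edges `ij` and `ik` of `G`, imposed on
`E_G` to obtain its commutative quotient. -/
inductive AbRel (K : Type*) [Field K] {n : ℕ} (G : SimpleGraph (Fin n)) :
    graphAlg K G → graphAlg K G → Prop
  | comm (i j k : Fin n) (hij : G.Adj i j) (hik : G.Adj i k) :
      AbRel K G (edgeX K hij * edgeX K hik) (edgeX K hik * edgeX K hij)

/-- The commutative quotient `E_G^{ab}`: the quotient of `E_G` by the two-sided ideal generated
by all `x_{ij} x_{ik} - x_{ik} x_{ij}` with `ij` and `ik` edges of `G`. -/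
abbrev AbAlg (K : Type*) [Field K] {n : ℕ} (G : SimpleGraph (Fin n)) : Type _ :=
  RingQuot (AbRel K G)

/-- The image of the generator `x_{ij}` in `E_G^{ab}`, for an edge `ij` of `G`. -/
noncomputable def abX (K : Type*) [Field K] {n : ℕ} {G : SimpleGraph (Fin n)} {i j : Fin n}
    (h : G.Adj i j) : AbAlg K G :=
  RingQuot.mkAlgHom K (AbRel K G) (edgeX K h)

/-- The component of degree `d` of `E_G^{ab}`: the `K`-span of all products of `d` generators
`x_{ij}`, `ij` an edge of `G`. -/
noncomputable def abDegree (K : Type*) [Field K] {n : ℕ} (G : SimpleGraph (Fin n)) (d : ℕ) :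
    Submodule K (AbAlg K G) :=
  Submodule.span K {y | ∃ (i j : Fin n) (h : G.Adj i j), y = abX K h} ^ d

/-- The Hilbert series of `E_G^{ab}`: the generating function of the dimensions of the graded
components. -/
noncomputable def abHilbertSeries (K : Type*) [Field K] {n : ℕ} (G : SimpleGraph (Fin n)) :
    PowerSeries ℚ :=
  PowerSeries.mk fun d => (Module.finrank K (abDegree K G d) : ℚ)

end FominKirillov

/-! Deletion and contraction drive the proof. Put `h_G(t) = (-t)^n χ_G(-1/t)`. The recursion `χ_G =
χ_{G-e} - χ_{G/e}`, together with the loss of one vertex under contraction, becomes `h_G = h_{G-e} +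
t h_{G/e}`, a recursion with nonnegative coefficients. `nbcCount` is defined by this recursion, with
contractions recorded by a labelling of the vertices. It remains to show that the degree `d` part of
`E_G^{ab}` has dimension `nbcCount G.adjList id d`.

Upper bound (`IsGraphOrlikTerao.exists_finset_span`): the generators commute, square to zero, and
satisfy one relation for every cycle of `G`: the product of all edges of the cycle but one is that
remaining edge times a combination of shorter products. The cycle relation comes from triangulating
the cycle inside the noncommutative `E_n`, where chords outside `G` are available
(`rotationSum_eq_neg_pathProd`); only then is it pushed to the quotient. These relations suffice to
span by as many elements as the recursion counts.

Lower bound (`nbcCount_le_finrank`): `E_G^{ab}` maps to the commutative algebra `OTAlg` on all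
vertex pairs with the three-term relations. There each pair `i ≠ j` has a residue, a twisted
derivation over the contraction of `j` to `i` (`OTAlg.exists_residue`). It kills the deletion part
when contraction creates no loop, and maps onto the contraction part, so rank-nullity gives the
recursion as an inequality.

Since the two bounds agree, the map to `OTAlg` is injective in each degree, and the grading of
`E_G^{ab}` is read off from a grading of `OTAlg`. -/

/-- The labelling obtained from `p` by giving the vertices labelled `p b` the label `p a`. -/
def mergeLabel {V : Type*} [DecidableEq V] (p : V → V) (a b : V) : V → V :=
  fun v => if p v = p b then p a else p v

/-! ### Deletion and contraction -/

section Counting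

variable {V : Type*} [DecidableEq V]

/-- The number of sets of `d` edges in the list `L` which contain no broken circuit, where
vertices with the same label under `p` are identified. -/
def nbcCount : List (V × V) → (V → V) → ℕ → ℕ
  | [], _, d => if d = 0 then 1 else 0
  | e :: L, p, 0 => if p e.1 = p e.2 then 0 else nbcCount L p 0
  | e :: L, p, d + 1 =>
    if p e.1 = p e.2 then 0 else nbcCount L p (d + 1) + nbcCount L (mergeLabel p e.1 e.2) d

theorem mergeLabel_congr (p : V → V) (a b : V) {u v : V} (h : p u = p v) :
    mergeLabel p a b u = mergeLabel p a b v := by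
  simp [mergeLabel, h]

theorem mergeLabel_eq_iff (p : V → V) (a b u v : V) :
    mergeLabel p a b u = mergeLabel p a b v ↔
      p u = p v ∨ (p u = p a ∧ p v = p b) ∨ (p u = p b ∧ p v = p a) := by
  unfold mergeLabel
  split_ifs <;> grind

theorem mergeLabel_left_eq_right (p : V → V) (a b : V) :
    mergeLabel p a b a = mergeLabel p a b b := by
  simp [mergeLabel_eq_iff]

/-- The recursion tests for a loop only at the head of the list. A loop further down survives every
merge, so each branch meets it eventually. -/
theorem nbcCount_eq_zero_of_loop (L : List (V × V)) (p : V → V) (d : ℕ) {e : V × V}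
    (he : e ∈ L) (hp : p e.1 = p e.2) : nbcCount L p d = 0 := by
  induction L generalizing p d with
  | nil => simp at he
  | cons f L ih =>
    by_cases hf : p f.1 = p f.2
    · cases d <;> simp [nbcCount, hf]
    · have he' : e ∈ L := by
        rcases List.mem_cons.1 he with rfl | h
        · exact absurd hp hf
        · exact h
      cases d with
      | zero => simp [nbcCount, ih p 0 he' hp]
      | succ d => simp [nbcCount, ih p (d + 1) he' hp, ih _ d he' (mergeLabel_congr p _ _ hp)]

variable [Fintype V]

theorem card_image_mergeLabel (p : V → V) {a b : V} (h : p a ≠ p b) :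
    (Finset.univ.image (mergeLabel p a b)).card + 1 = (Finset.univ.image p).card := by
  have : Finset.univ.image (mergeLabel p a b) = (Finset.univ.image p).erase (p b) := by
    ext w
    simp only [Finset.mem_image, Finset.mem_univ, true_and, Finset.mem_erase, mergeLabel]
    constructor
    · rintro ⟨v, rfl⟩
      split_ifs with hv
      · exact ⟨h, a, rfl⟩
      · exact ⟨hv, v, rfl⟩
    · rintro ⟨hw, v, rfl⟩
      exact ⟨v, if_neg hw⟩
  rw [this, Finset.card_erase_add_one]
  simp

/-- The polynomial counting the colourings which are constant on the vertices with a given label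
under `p` and proper on the edges in `L`, computed by deletion and contraction. -/
noncomputable def listChromatic : List (V × V) → (V → V) → Polynomial ℤ
  | [], p => Polynomial.X ^ (Finset.univ.image p).card
  | e :: L, p =>
    if p e.1 = p e.2 then 0
    else listChromatic L p - listChromatic L (mergeLabel p e.1 e.2)

theorem card_factorsThrough (p : V → V) (q : ℕ) :
    Nat.card {f : V → Fin q // ∀ u v, p u = p v → f u = f v} =
      q ^ (Finset.univ.image p).card := by
  have e : {f : V → Fin q // ∀ u v, p u = p v → f u = f v} ≃ (Set.range p → Fin q) :=
    (Equiv.subtypeEquivRight fun f =>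
      ⟨fun h u v huv => h u v huv, fun h _ _ huv => h huv⟩ :
        {f : V → Fin q // ∀ u v, p u = p v → f u = f v} ≃ {f // Setoid.ker p ≤ Setoid.ker f}).trans
      ((Setoid.liftEquiv (Setoid.ker p)).trans
        (Equiv.arrowCongr (Setoid.quotientKerEquivRange p) (Equiv.refl _)))
  rw [Nat.card_congr e, Nat.card_fun]
  rw [Nat.card_fin, Nat.card_coe_set_eq, ← Set.ncard_coe_finset, Finset.coe_image,
    Finset.coe_univ, Set.image_univ]

/-- Colourings proper on `L` and constant on labels split by whether the ends of `e` receive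
different colours or the same one. The latter are exactly the colourings constant on the merged
labels. -/
theorem listChromatic_eval (L : List (V × V)) (p : V → V) (q : ℕ) :
    (listChromatic L p).eval (q : ℤ) =
      (Nat.card {f : V → Fin q // (∀ u v, p u = p v → f u = f v) ∧
        ∀ e ∈ L, f e.1 ≠ f e.2} : ℤ) := by
  induction L generalizing p with
  | nil =>
    have := card_factorsThrough p q
    simp only [Nat.card_eq_fintype_card] at this
    simp [listChromatic, this]
  | cons e L ih =>
    rw [listChromatic]
    split_ifs with h
    · have : IsEmpty {f : V → Fin q // (∀ u v, p u = p v → f u = f v) ∧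
          ∀ g ∈ e :: L, f g.1 ≠ f g.2} :=
        ⟨fun f => f.2.2 e (by simp) (f.2.1 _ _ h)⟩
      rw [Nat.card_of_isEmpty, Polynomial.eval_zero, Nat.cast_zero]
    · rw [Polynomial.eval_sub, ih, ih, sub_eq_iff_eq_add, ← Nat.cast_add, Nat.cast_inj]
      simp only [Nat.card_eq_fintype_card, Fintype.card_subtype]
      rw [← Finset.card_union_of_disjoint]
      · congr 1
        ext f
        simp only [Finset.mem_filter, Finset.mem_univ, true_and, Finset.mem_union,
          List.mem_cons, forall_eq_or_imp, mergeLabel_eq_iff]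
        constructor
        · rintro ⟨h1, h2⟩
          by_cases hf : f e.1 = f e.2
          · refine Or.inr ⟨?_, h2⟩
            rintro u v (h3 | ⟨h3, h4⟩ | ⟨h3, h4⟩)
            · exact h1 _ _ h3
            · rw [h1 _ _ h3, h1 _ _ h4, hf]
            · rw [h1 _ _ h3, h1 _ _ h4, hf]
          · exact Or.inl ⟨h1, hf, h2⟩
        · rintro (⟨h1, -, h2⟩ | ⟨h1, h2⟩)
          · exact ⟨h1, h2⟩
          · exact ⟨fun u v huv => h1 u v (Or.inl huv), h2⟩
      · rw [Finset.disjoint_left]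
        intro f hf hf'
        simp only [Finset.mem_filter, Finset.mem_univ, true_and] at hf hf'
        exact hf.2 e (by simp) (hf'.1 _ _ (mergeLabel_left_eq_right p e.1 e.2))

/-- A merge lowers the number of labels by one, so the minus sign in deletion-contraction is
absorbed by the spare factor `-T`, leaving the term `+T` times the contraction. -/
theorem ofPowerSeries_mk_nbcCount (L : List (V × V)) (p : V → V) :
    HahnSeries.ofPowerSeries ℤ ℚ (PowerSeries.mk fun d => (nbcCount L p d : ℚ)) =
      (-(HahnSeries.single (1 : ℤ) (1 : ℚ) : LaurentSeries ℚ)) ^ (Finset.univ.image p).card *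
        Polynomial.aeval (-(HahnSeries.single (1 : ℤ) (1 : ℚ) : LaurentSeries ℚ)⁻¹)
          (listChromatic L p) := by
  have hT : (HahnSeries.single (1 : ℤ) (1 : ℚ) : LaurentSeries ℚ) ≠ 0 :=
    HahnSeries.single_ne_zero one_ne_zero
  induction L generalizing p with
  | nil =>
    have : (PowerSeries.mk fun d => (nbcCount ([] : List (V × V)) p d : ℚ)) = 1 := by
      ext d
      simp [nbcCount, PowerSeries.coeff_one]
    rw [this, listChromatic, map_pow, Polynomial.aeval_X, ← mul_pow, neg_mul_neg,
      mul_inv_cancel₀ hT, one_pow, map_one]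
  | cons e L ih =>
    by_cases h : p e.1 = p e.2
    · have : (PowerSeries.mk fun d => (nbcCount (e :: L) p d : ℚ)) = 0 := by
        ext d
        cases d <;> simp [nbcCount, h]
      simp [this, listChromatic, h]
    · have : (PowerSeries.mk fun d => (nbcCount (e :: L) p d : ℚ)) =
          (PowerSeries.mk fun d => (nbcCount L p d : ℚ)) + PowerSeries.X *
            (PowerSeries.mk fun d => (nbcCount L (mergeLabel p e.1 e.2) d : ℚ)) := by
        ext d
        cases d with
        | zero => simp [nbcCount, h]
        | succ d => simp [nbcCount, h, PowerSeries.coeff_succ_X_mul]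
      rw [this, map_add, map_mul, ih, ih, HahnSeries.ofPowerSeries_X, listChromatic, if_neg h,
        map_sub, ← card_image_mergeLabel p h, pow_succ]
      ring

end Counting

/-! ### The chromatic polynomial of a graph and of the complete graph -/

section ChromaticPolynomial

theorem SimpleGraph.eq_chromaticPolynomial {V : Type*} [Finite V] (G : SimpleGraph V)
    {χ : Polynomial ℤ} (h : ∀ q : ℕ, χ.eval (q : ℤ) = (Nat.card (G.Coloring (Fin q)) : ℤ)) :
    χ = G.chromaticPolynomial :=
  G.existsUnique_chromaticPolynomial.unique h G.chromaticPolynomial_eval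

open Classical in
/-- The list of the pairs of adjacent vertices of a graph. -/
noncomputable def SimpleGraph.adjList {V : Type*} [Fintype V] (G : SimpleGraph V) :
    List (V × V) :=
  (Finset.univ.filter fun e : V × V => G.Adj e.1 e.2).toList

@[simp]
theorem SimpleGraph.mem_adjList {V : Type*} [Fintype V] (G : SimpleGraph V) (e : V × V) :
    e ∈ G.adjList ↔ G.Adj e.1 e.2 := by
  simp [adjList]

/-- Each edge occurs in `adjList` in both orientations. This is harmless: the second occurrence
repeats the same condition on colourings. -/
theorem listChromatic_adjList {V : Type*} [Fintype V] [DecidableEq V] (G : SimpleGraph V) :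
    listChromatic G.adjList id = G.chromaticPolynomial := by
  refine G.eq_chromaticPolynomial fun q => ?_
  rw [listChromatic_eval, Nat.cast_inj]
  exact Nat.card_congr
    { toFun := fun f => SimpleGraph.Coloring.mk f.1 fun {u v} h => f.2.2 (u, v) (by simpa using h)
      invFun := fun f => ⟨f, fun u v h => congrArg f h, fun e he =>
        f.valid ((G.mem_adjList e).1 he)⟩
      left_inv := fun f => rfl
      right_inv := fun f => rfl }

theorem SimpleGraph.chromaticPolynomial_top (n : ℕ) :
    (⊤ : SimpleGraph (Fin n)).chromaticPolynomial = descPochhammer ℤ n := by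
  refine ((⊤ : SimpleGraph (Fin n)).eq_chromaticPolynomial fun q => ?_).symm
  have e : (⊤ : SimpleGraph (Fin n)).Coloring (Fin q) ≃ (Fin n ↪ Fin q) :=
    { toFun := fun f => ⟨f, fun u v h => by
        by_contra hne
        exact f.valid ((SimpleGraph.top_adj u v).2 hne) h⟩
      invFun := fun f => SimpleGraph.Coloring.mk f fun {u v} h => f.injective.ne h
      left_inv := fun f => rfl
      right_inv := fun f => rfl }
  rw [descPochhammer_eval_eq_descFactorial, Nat.card_congr e, Nat.card_eq_fintype_card,
    Fintype.card_embedding_eq, Fintype.card_fin, Fintype.card_fin]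

theorem neg_pow_mul_aeval_descPochhammer {F : Type*} [Field F] [Algebra ℤ F] {T : F} (hT : T ≠ 0) (n : ℕ) :
    (-T) ^ n * Polynomial.aeval (-T⁻¹) (descPochhammer ℤ n) =
      ∏ k ∈ Finset.range n, (1 + (k : F) * T) := by
  induction n with
  | zero => simp
  | succ n ih =>
    rw [descPochhammer_succ_right, Finset.prod_range_succ, ← ih, map_mul, map_sub,
      Polynomial.aeval_X, map_natCast]
    field_simp
    ring

end ChromaticPolynomial

/-! ### The universal commutative algebra with three-term relations, and its residues -/

section OrlikTerao

/-- A family `X u v` in a commutative ring satisfying the relations of the generators of the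
commutative quotient of the Fomin-Kirillov algebra, where also `X u u = 0`. -/
structure IsOrlikTerao {V A : Type*} [CommRing A] (X : V → V → A) : Prop where
  diag : ∀ u, X u u = 0
  antisymm : ∀ u v, X u v = -X v u
  cyclic : ∀ u v w, X u v * X v w + X v w * X w u + X w u * X u v = 0

namespace IsOrlikTerao

variable {V A : Type*} [CommRing A] {X : V → V → A}

theorem sq (h : IsOrlikTerao X) (u v : V) : X u v ^ 2 = 0 := by
  have := h.cyclic u v u
  rw [h.diag u, h.antisymm v u] at this
  linear_combination -this

/-- A deformation of an Orlik-Terao family over the dual numbers, concentrated on pairs of vertices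
which are identified by `c`. -/
theorem deform (h : IsOrlikTerao X) {c : V → V} {D : V → V → A} (hD₀ : ∀ u, D u u = 0)
    (hD : ∀ u v, D u v = -D v u) (hDc : ∀ u v, D u v ≠ 0 → c u = c v) :
    IsOrlikTerao fun u v =>
      (TrivSqZeroExt.inl (X (c u) (c v)) + TrivSqZeroExt.inr (D u v) : DualNumber A) := by
  -- The `ε`-part of the cyclic relation is a sum of three such terms; when `c u = c v`,
  -- antisymmetry makes the bracket vanish.
  have key : ∀ u v w, D u v * (X (c v) (c w) + X (c w) (c u)) = 0 := by
    intro u v w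
    by_cases huv : D u v = 0
    · rw [huv, zero_mul]
    · rw [hDc u v huv, h.antisymm (c v) (c w), neg_add_cancel, mul_zero]
  refine ⟨fun u => ?_, fun u v => ?_, fun u v w => ?_⟩
  · simp [h.diag, hD₀]
  · rw [h.antisymm, hD]
    simp [add_comm]
  · ext
    · simpa using h.cyclic (c u) (c v) (c w)
    · simp only [DualNumber.snd_mul, TrivSqZeroExt.snd_add, TrivSqZeroExt.fst_add,
        TrivSqZeroExt.fst_inl, TrivSqZeroExt.fst_inr, TrivSqZeroExt.snd_inl,
        TrivSqZeroExt.snd_inr, TrivSqZeroExt.snd_zero, add_zero, zero_add]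
      linear_combination key u v w + key v w u + key w u v

/-- The relations are homogeneous, so the generators may be scaled by an indeterminate. The
resulting homomorphism records degrees. -/
theorem polynomial (h : IsOrlikTerao X) :
    IsOrlikTerao fun u v => Polynomial.C (X u v) * (Polynomial.X : Polynomial A) := by
  refine ⟨fun u => by simp [h.diag], fun u v => by rw [h.antisymm]; simp, fun u v w => ?_⟩
  have := congrArg (Polynomial.C (R := A)) (h.cyclic u v w)
  simp only [map_add, map_mul, map_zero] at this
  linear_combination Polynomial.X ^ 2 * this

end IsOrlikTerao

open MvPolynomial in
/-- The relations of the commutative algebra with a universal Orlik-Terao family. -/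
def otRelations (K V : Type*) [Field K] : Set (MvPolynomial (V × V) K) :=
  {r | (∃ u, r = X (u, u)) ∨ (∃ u v, r = X (u, v) + X (v, u)) ∨
    ∃ u v w, r = X (u, v) * X (v, w) + X (v, w) * X (w, u) + X (w, u) * X (u, v)}

/-- The commutative algebra with a universal Orlik-Terao family indexed by `V`. -/
abbrev OTAlg (K V : Type*) [Field K] : Type _ :=
  MvPolynomial (V × V) K ⧸ Ideal.span (otRelations K V)

namespace OTAlg

variable (K : Type*) {V : Type*} [Field K]

/-- The universal Orlik-Terao family. -/
noncomputable def gen (u v : V) : OTAlg K V :=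
  Ideal.Quotient.mk _ (MvPolynomial.X (u, v))

theorem isOrlikTerao_gen : IsOrlikTerao (gen K : V → V → OTAlg K V) := by
  have key : ∀ r ∈ otRelations K V, Ideal.Quotient.mk (Ideal.span (otRelations K V)) r = 0 :=
    fun r hr => Ideal.Quotient.eq_zero_iff_mem.2 (Ideal.subset_span hr)
  refine ⟨fun u => key _ (Or.inl ⟨u, rfl⟩), fun u v => eq_neg_of_add_eq_zero_left ?_,
    fun u v w => ?_⟩
  · simpa only [map_add, gen] using key _ (Or.inr (Or.inl ⟨u, v, rfl⟩))
  · simpa only [map_add, map_mul, gen] using key _ (Or.inr (Or.inr ⟨u, v, w, rfl⟩))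

variable {K} {A : Type*} [CommRing A] [Algebra K A] {X : V → V → A}

/-- The algebra homomorphism given by an Orlik-Terao family. -/
noncomputable def lift (h : IsOrlikTerao X) : OTAlg K V →ₐ[K] A :=
  Ideal.Quotient.liftₐ _ (MvPolynomial.aeval fun e : V × V => X e.1 e.2) <| by
    have : Ideal.span (otRelations K V) ≤
        RingHom.ker (MvPolynomial.aeval fun e : V × V => X e.1 e.2 : _ →ₐ[K] A) := by
      rw [Ideal.span_le]
      rintro r (⟨u, rfl⟩ | ⟨u, v, rfl⟩ | ⟨u, v, w, rfl⟩)
      · simp [h.diag]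
      · simp [h.antisymm u v]
      · simp [h.cyclic]
    exact fun r hr => this hr

@[simp]
theorem lift_gen (h : IsOrlikTerao X) (u v : V) : lift (K := K) h (gen K u v) = X u v :=
  (Ideal.Quotient.liftₐ_apply _ _ _ _).trans
    ((Ideal.Quotient.lift_mk _ _ _).trans (MvPolynomial.aeval_X _ _))

instance : Nontrivial (OTAlg K V) :=
  (lift (K := K) (X := fun _ _ : V => (0 : K))
    ⟨by simp, by simp, by simp⟩ : OTAlg K V →ₐ[K] K).toRingHom.domain_nontrivial

/-- The contraction of the vertex `j` to `i` and the residue along `gen K i j`. -/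
theorem exists_residue [DecidableEq V] {i j : V} (hij : i ≠ j) (c : V → V)
    (hc : ∀ v, c v = if v = j then i else v) :
    ∃ (φ : OTAlg K V →ₐ[K] OTAlg K V) (R : OTAlg K V →ₗ[K] OTAlg K V),
      (∀ u v, φ (gen K u v) = gen K (c u) (c v)) ∧
      (∀ a b, R (a * b) = φ a * R b + R a * φ b) ∧
      (∀ u v, c u ≠ c v → R (gen K u v) = 0) ∧ R (gen K i j) = 1 := by
  let D : V → V → OTAlg K V := fun u v =>
    if u = i ∧ v = j then 1 else if u = j ∧ v = i then -1 else 0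
  have hDc : ∀ u v, D u v ≠ 0 → c u = c v := by
    intro u v
    simp only [D, hc]
    split_ifs <;> grind
  have hD : IsOrlikTerao _ := (isOrlikTerao_gen K (V := V)).deform (c := c) (D := D)
    (fun u => by
      simp only [D]
      rw [if_neg (by grind), if_neg (by grind)])
    (fun u v => by
      simp only [D]
      by_cases h1 : u = i ∧ v = j
      · rw [if_pos h1, if_neg (by grind), if_pos h1.symm, neg_neg]
      · by_cases h2 : u = j ∧ v = i
        · rw [if_neg h1, if_pos h2, if_pos h2.symm]
        · rw [if_neg h1, if_neg h2, if_neg (by grind), if_neg (by grind), neg_zero]) hDc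
  -- The deformation is one homomorphism to the dual numbers. Its constant part is the contraction
  -- `φ`, and its `ε`-part is the residue `R`; the product rule is multiplication of dual numbers.
  refine ⟨(TrivSqZeroExt.fstHom K (OTAlg K V) (OTAlg K V)).comp (lift hD),
    ((TrivSqZeroExt.sndHom (OTAlg K V) (OTAlg K V)).restrictScalars K).comp
      (lift hD).toLinearMap, fun u v => ?_, fun a b => ?_, fun u v huv => ?_, ?_⟩
  · change TrivSqZeroExt.fst (lift hD (gen K u v)) = _
    rw [lift_gen]
    simp
  · change TrivSqZeroExt.snd (lift hD (a * b)) = _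
    rw [map_mul]
    exact DualNumber.snd_mul _ _
  · change TrivSqZeroExt.snd (lift hD (gen K u v)) = 0
    rw [lift_gen]
    simpa using not_imp_comm.1 (hDc u v) huv
  · change TrivSqZeroExt.snd (lift hD (gen K i j)) = 1
    rw [lift_gen]
    simp [D]

end OTAlg

/-! ### Lower bound for dimensions by residues -/

section LowerBound

variable {K A V : Type*} [Field K] [CommRing A] [Algebra K A]

/-- The span of the elements `X (p u) (p v)` for the pairs `(u, v)` in `L`. -/
def labelSpan (K : Type*) [Field K] [Algebra K A] (X : V → V → A) (p : V → V)
    (L : List (V × V)) : Submodule K A :=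
  Submodule.span K {y | ∃ e ∈ L, y = X (p e.1) (p e.2)}

theorem labelSpan_cons (X : V → V → A) (p : V → V) (e : V × V) (L : List (V × V)) :
    labelSpan K X p (e :: L) = Submodule.span K {X (p e.1) (p e.2)} ⊔ labelSpan K X p L := by
  rw [labelSpan, labelSpan, ← Submodule.span_union]
  congr 1
  ext y
  simp

theorem labelSpan_le_cons (X : V → V → A) (p : V → V) (e : V × V) (L : List (V × V)) :
    labelSpan K X p L ≤ labelSpan K X p (e :: L) := by
  rw [labelSpan_cons]
  exact le_sup_right

instance (X : V → V → A) (p : V → V) (L : List (V × V)) (d : ℕ) :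
    Module.Finite K ↥(labelSpan K X p L ^ d) := by
  refine Module.Finite.iff_fg.2 (Submodule.FG.pow (Submodule.fg_span ?_) d)
  refine (L.finite_toSet.image fun e => X (p e.1) (p e.2)).subset ?_
  rintro _ ⟨e, he, rfl⟩
  exact ⟨e, he, rfl⟩

theorem map_labelSpan_pow {B : Type*} [CommRing B] [Algebra K B] (f : A →ₐ[K] B)
    (X : V → V → A) (Y : V → V → B) (p q : V → V) (L : List (V × V)) (d : ℕ)
    (h : ∀ e ∈ L, f (X (p e.1) (p e.2)) = Y (q e.1) (q e.2)) :
    (labelSpan K X p L ^ d).map f.toLinearMap = labelSpan K Y q L ^ d := by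
  rw [Submodule.map_pow, labelSpan, labelSpan, Submodule.map_span]
  congr 2
  ext y
  constructor
  · rintro ⟨_, ⟨e, he, rfl⟩, rfl⟩
    exact ⟨e, he, h e he⟩
  · rintro ⟨e, he, rfl⟩
    exact ⟨_, ⟨e, he, rfl⟩, h e he⟩

/-- Rank-nullity for `R` restricted to `Z`: `Z₀` lies in the kernel and `Z₁` in the image. -/
theorem finrank_add_finrank_le {E F : Type*} [AddCommGroup E] [Module K E] [AddCommGroup F]
    [Module K F] (R : E →ₗ[K] F) {Z Z₀ : Submodule K E} {Z₁ : Submodule K F} [Module.Finite K Z]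
    (h₀ : Z₀ ≤ Z) (hR : Z₀ ≤ LinearMap.ker R) (h₁ : Z₁ ≤ Z.map R) :
    Module.finrank K Z₀ + Module.finrank K Z₁ ≤ Module.finrank K Z := by
  rw [← LinearMap.finrank_range_add_finrank_ker (R.domRestrict Z), add_comm]
  refine add_le_add ?_ ?_
  · rw [LinearMap.range_domRestrict]
    exact Submodule.finrank_mono h₁
  · rw [← Submodule.finrank_map_subtype_eq Z (LinearMap.ker (R.domRestrict Z))]
    refine Submodule.finrank_mono fun z hz => ?_
    exact ⟨⟨z, h₀ hz⟩, by simpa using hR hz, rfl⟩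

theorem nbcCount_le_finrank [DecidableEq V] (L : List (V × V)) (p : V → V) (d : ℕ) :
    nbcCount L p d ≤ Module.finrank K ↥(labelSpan K (OTAlg.gen K) p L ^ d) := by
  induction L generalizing p d with
  | nil =>
    cases d with
    | zero =>
      rw [pow_zero, Submodule.one_eq_span, finrank_span_singleton one_ne_zero]
      simp [nbcCount]
    | succ d => simp [nbcCount]
  | cons e L ih =>
    by_cases hp : p e.1 = p e.2
    · rw [nbcCount_eq_zero_of_loop (e :: L) p d (by simp) hp]
      exact Nat.zero_le _
    have hmono (d) : labelSpan K (OTAlg.gen K) p L ^ d ≤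
        labelSpan K (OTAlg.gen K) p (e :: L) ^ d :=
      pow_le_pow_left' (labelSpan_le_cons _ _ _ _) d
    cases d with
    | zero =>
      simp only [nbcCount, if_neg hp]
      exact (ih p 0).trans (Submodule.finrank_mono (hmono 0))
    | succ d =>
      simp only [nbcCount, if_neg hp]
      -- If contracting `e` makes some `f ∈ L` a loop, the residue need not kill `f`; but then the
      -- contraction term is zero and deletion alone suffices.
      by_cases hloop : ∃ f ∈ L, mergeLabel p e.1 e.2 f.1 = mergeLabel p e.1 e.2 f.2
      · obtain ⟨f, hf, hf'⟩ := hloop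
        rw [nbcCount_eq_zero_of_loop L _ d hf hf', add_zero]
        exact (ih p (d + 1)).trans (Submodule.finrank_mono (hmono (d + 1)))
      push Not at hloop
      refine (add_le_add (ih p (d + 1)) (ih (mergeLabel p e.1 e.2) d)).trans ?_
      let c : V → V := fun v => if v = p e.2 then p e.1 else v
      have hc (v) : c (p v) = mergeLabel p e.1 e.2 v := rfl
      obtain ⟨φ, R, hφ, hRmul, hRgen, hRe⟩ := OTAlg.exists_residue (K := K) hp c fun _ => rfl
      have hR1 : R 1 = 0 := by
        have := hRmul 1 1
        rwa [mul_one, map_one φ, one_mul, mul_one, left_eq_add] at this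
      have hR₀ (d) : labelSpan K (OTAlg.gen K) p L ^ d ≤ LinearMap.ker R := by
        intro a ha
        induction d generalizing a with
        | zero =>
          rw [pow_zero, Submodule.mem_one] at ha
          obtain ⟨k, rfl⟩ := ha
          rw [LinearMap.mem_ker, Algebra.algebraMap_eq_smul_one, map_smul, hR1, smul_zero]
        | succ d ih' =>
          rw [pow_succ] at ha
          refine Submodule.mul_induction_on ha (fun a ha b hb => ?_) fun a b => add_mem
          have hb : R b = 0 := by
            refine (Submodule.span_le (p := LinearMap.ker R)).2 ?_ hb
            rintro _ ⟨f, hf, rfl⟩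
            exact hRgen _ _ (hloop f hf)
          rw [LinearMap.mem_ker, hRmul, hb, ih' ha]
          simp
      refine finrank_add_finrank_le R (hmono (d + 1)) (hR₀ _) ?_
      rw [← map_labelSpan_pow φ (OTAlg.gen K) (OTAlg.gen K) p _ L d fun f _ => by
        rw [hφ, hc, hc]]
      -- Since `R a = 0` and `R` is `1` on the generator of `e`, the product of that generator with
      -- `a` has residue `φ a`.
      rintro _ ⟨a, ha, rfl⟩
      refine ⟨OTAlg.gen K (p e.1) (p e.2) * a, ?_, ?_⟩
      · rw [SetLike.mem_coe, pow_succ']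
        refine Submodule.mul_mem_mul (Submodule.subset_span ⟨e, by simp, rfl⟩) (hmono d ha)
      · have h1 : R a = 0 := hR₀ d ha
        rw [hRmul, h1, hRe, mul_zero, zero_add, one_mul]
        rfl

end LowerBound

end OrlikTerao

/-! ### The cycle relation in the noncommutative algebra -/

section CycleRelation

variable {R : Type*} [Semiring R]

/-- The product `y 0 * y 1 * ⋯ * y (r - 1)`. -/
def pathProd (y : ℕ → R) : ℕ → R
  | 0 => 1
  | r + 1 => pathProd y r * y r

/-- The sum over `j < r` of `(y (j + 1) ⋯ y (r - 1)) * z * (y 0 ⋯ y (j - 1))`. -/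
def rotationSum (y : ℕ → R) : ℕ → R → R
  | 0, _ => 0
  | r + 1, z => rotationSum y r (y r * z) + z * pathProd y r

theorem map_pathProd {S F : Type*} [Semiring S] [FunLike F R S] [RingHomClass F R S] (f : F)
    (y : ℕ → R) (r : ℕ) : f (pathProd y r) = pathProd (fun i => f (y i)) r := by
  induction r with
  | zero => simp [pathProd]
  | succ r ih => simp [pathProd, ih]

theorem map_rotationSum {S F : Type*} [Semiring S] [FunLike F R S] [RingHomClass F R S] (f : F)
    (y : ℕ → R) (r : ℕ) (z : R) :
    f (rotationSum y r z) = rotationSum (fun i => f (y i)) r (f z) := by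
  induction r generalizing z with
  | zero => simp [rotationSum]
  | succ r ih => simp [rotationSum, ih, map_pathProd]

theorem pathProd_congr {y y' : ℕ → R} {r : ℕ} (h : ∀ i < r, y i = y' i) :
    pathProd y r = pathProd y' r := by
  induction r with
  | zero => rfl
  | succ r ih => rw [pathProd, pathProd, ih fun i hi => h i (by omega), h r (by omega)]

theorem rotationSum_congr {y y' : ℕ → R} {r : ℕ} (h : ∀ i < r, y i = y' i) (z : R) :
    rotationSum y r z = rotationSum y' r z := by
  induction r generalizing z with
  | zero => rfl
  | succ r ih =>
    rw [rotationSum, rotationSum, h r (by omega), ih fun i hi => h i (by omega),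
      pathProd_congr fun i hi => h i (by omega)]

theorem rotationSum_add (y : ℕ → R) (r : ℕ) (z z' : R) :
    rotationSum y r (z + z') = rotationSum y r z + rotationSum y r z' := by
  induction r generalizing z z' with
  | zero => simp [rotationSum]
  | succ r ih =>
    simp only [rotationSum, mul_add, add_mul, ih]
    abel

/-- The factors standing to the left of `z` have positive index, so `u` need not commute with `y 0`.
-/
theorem rotationSum_mul_left (y : ℕ → R) (r : ℕ) (u z : R)
    (h : ∀ j < r, 0 < j → Commute u (y j)) :
    rotationSum y r (u * z) = u * rotationSum y r z := by
  induction r generalizing z with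
  | zero => simp [rotationSum]
  | succ r ih =>
    rw [rotationSum, rotationSum, mul_add, mul_assoc, ← ih _ fun j hj => h j (by omega)]
    rcases Nat.eq_zero_or_pos r with rfl | hr
    · rfl
    · rw [← mul_assoc, ← (h r (by omega) hr).eq, mul_assoc]

theorem commute_pathProd {y : ℕ → R} {r : ℕ} {u : R} (h : ∀ j < r, Commute u (y j)) :
    Commute u (pathProd y r) := by
  induction r with
  | zero => exact Commute.one_right u
  | succ r ih => exact (ih fun j hj => h j (by omega)).mul_right (h r (by omega))

/-- The factors standing to the right of `z` have index below `r - 1`, so `u` need not commute with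
the last factor. -/
theorem rotationSum_mul_right (y : ℕ → R) (r : ℕ) (u z : R)
    (h : ∀ j, j + 1 < r → Commute u (y j)) :
    rotationSum y r (z * u) = rotationSum y r z * u := by
  induction r generalizing z with
  | zero => simp [rotationSum]
  | succ r ih =>
    rw [rotationSum, rotationSum, add_mul, ← mul_assoc, ih _ fun j hj => h j (by omega),
      mul_assoc, mul_assoc, (commute_pathProd fun j hj => h j (by omega)).eq]

theorem pathProd_eq {R : Type*} [CommSemiring R] (y : ℕ → R) (r : ℕ) :
    pathProd y r = ∏ i ∈ Finset.range r, y i := by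
  induction r with
  | zero => rfl
  | succ r ih => rw [pathProd, ih, Finset.prod_range_succ]

theorem rotationSum_eq {R : Type*} [CommSemiring R] (y : ℕ → R) (r : ℕ) (z : R) :
    rotationSum y r z =
      z * ∑ j ∈ Finset.range r, ∏ i ∈ (Finset.range r).erase j, y i := by
  induction r generalizing z with
  | zero => simp [rotationSum]
  | succ r ih =>
    have h1 : (Finset.range (r + 1)).erase r = Finset.range r := by
      rw [Finset.range_add_one, Finset.erase_insert Finset.notMem_range_self]
    have h2 : ∀ j ∈ Finset.range r, ∏ i ∈ (Finset.range (r + 1)).erase j, y i =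
        y r * ∏ i ∈ (Finset.range r).erase j, y i := by
      intro j hj
      rw [Finset.range_add_one, Finset.erase_insert_of_ne (by grind), Finset.prod_insert]
      grind
    rw [rotationSum, ih, pathProd_eq, Finset.sum_range_succ, h1, Finset.sum_congr rfl h2,
      ← Finset.mul_sum]
    ring

/-- The cycle relation, in a ring satisfying the quadratic relations of the Fomin-Kirillov algebra:
the sum of the products along the paths obtained from a cycle by deleting an edge vanishes. -/
theorem rotationSum_eq_neg_pathProd {R V : Type*} [Ring R] (X : V → V → R)
    (antisymm : ∀ i j, i ≠ j → X i j = -X j i)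
    (comm : ∀ i j k l, i ≠ j → i ≠ k → i ≠ l → j ≠ k → j ≠ l → k ≠ l →
      Commute (X i j) (X k l))
    (cyclic : ∀ i j k, i ≠ j → j ≠ k → k ≠ i →
      X i j * X j k + X j k * X k i + X k i * X i j = 0)
    (v : ℕ → V) (r : ℕ) (hr : 0 < r) (hv : Set.InjOn v {i | i ≤ r}) :
    rotationSum (fun i => X (v i) (v (i + 1))) r (X (v r) (v 0)) =
      -pathProd (fun i => X (v i) (v (i + 1))) r := by
  induction r, hr using Nat.le_induction with
  | base =>
    have : v 1 ≠ v 0 := fun h => absurd (hv (by simp) (by simp) h) one_ne_zero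
    simp [rotationSum, pathProd, antisymm _ _ this]
  | succ r hr ih =>
    have ne : ∀ i j, i ≤ r + 1 → j ≤ r + 1 → i ≠ j → v i ≠ v j :=
      fun i j hi hj hij h => hij (hv hi hj h)
    -- The three-term relation of the triangle cut off by the chord from `v r` to `v 0`. This chord
    -- closes the shorter cycle of the induction hypothesis.
    have h1 : X (v r) (v (r + 1)) * X (v (r + 1)) (v 0) =
        X (v (r + 1)) (v 0) * X (v r) (v 0) + X (v r) (v 0) * X (v r) (v (r + 1)) := by
      have := cyclic (v r) (v (r + 1)) (v 0) (ne _ _ (by omega) (by omega) (by omega))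
        (ne _ _ (by omega) (by omega) (by omega)) (ne _ _ (by omega) (by omega) (by omega))
      rw [antisymm (v 0) (v r) (ne _ _ (by omega) (by omega) (by omega))] at this
      rw [add_assoc, mul_neg, neg_mul, ← neg_add, ← sub_eq_add_neg, sub_eq_zero] at this
      exact this
    -- The outer factors share no vertex with the edges they must cross. By induction the first
    -- summand is minus the product of the closing edge and the shorter path, which cancels the last
    -- term of `rotationSum`.
    rw [rotationSum, h1, rotationSum_add, rotationSum_mul_left, rotationSum_mul_right, pathProd,
      ih fun i hi j hj h => hv (le_trans (Set.mem_ofPred.1 hi) (by omega))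
        (le_trans (Set.mem_ofPred.1 hj) (by omega)) h]
    · noncomm_ring
    · intro j hj
      apply comm <;> refine ne _ _ ?_ ?_ ?_ <;> omega
    · intro j hj hj0
      apply comm <;> refine ne _ _ ?_ ?_ ?_ <;> omega

end CycleRelation

/-! ### Upper bound for dimensions from the cycle relations -/

section UpperBound

variable {K U V : Type*} [Field K] [CommRing U] [Algebra K U] {X : V → V → U}
  {G : SimpleGraph V}

/-- The relations holding between the generators of the commutative quotient of the Fomin-Kirillov
algebra of the graph `G`. -/
structure IsGraphOrlikTerao (G : SimpleGraph V) (X : V → V → U) : Prop where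
  antisymm : ∀ u v, G.Adj u v → X u v = -X v u
  sq : ∀ u v, G.Adj u v → X u v ^ 2 = 0
  cycle : ∀ (v : ℕ → V) (r : ℕ), 0 < r → Set.InjOn v {i | i ≤ r} →
    (∀ i < r, G.Adj (v i) (v (i + 1))) → G.Adj (v r) (v 0) →
    ∏ i ∈ Finset.range r, X (v i) (v (i + 1)) =
      X (v 0) (v r) * ∑ j ∈ Finset.range r,
        ∏ i ∈ (Finset.range r).erase j, X (v i) (v (i + 1))

theorem Finset.prod_eq_prod_sdiff_image_mul [DecidableEq V] {M ι : Type*} [CommMonoid M]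
    {C : Finset V} {s : Finset ι} {e : ι → V} (hs : ∀ i ∈ s, e i ∈ C) (he : Set.InjOn e s)
    (f : V → M) : ∏ c ∈ C, f c = (∏ c ∈ C \ s.image e, f c) * ∏ i ∈ s, f (e i) := by
  rw [← Finset.prod_image he, Finset.prod_sdiff]
  simpa [Finset.image_subset_iff] using hs

theorem Finset.prod_erase_eq_prod_sdiff_image_mul [DecidableEq V] {M ι : Type*} [CommMonoid M]
    [DecidableEq ι] {C : Finset V} {s : Finset ι} {e : ι → V} (hs : ∀ i ∈ s, e i ∈ C)
    (he : Set.InjOn e s) (f : V → M) {j : ι} (hj : j ∈ s) :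
    ∏ c ∈ C.erase (e j), f c = (∏ c ∈ C \ s.image e, f c) * ∏ i ∈ s.erase j, f (e i) := by
  have h : ∀ i ∈ s.erase j, e i ∈ C.erase (e j) := fun i hi => by
    rw [Finset.mem_erase] at hi ⊢
    exact ⟨fun h => hi.1 (he hi.2 hj h), hs i hi.2⟩
  rw [Finset.prod_eq_prod_sdiff_image_mul h (he.mono (by simp))]
  congr 2
  ext c
  simp only [Finset.mem_sdiff, Finset.mem_erase, Finset.mem_image, not_exists, not_and]
  constructor
  · rintro ⟨⟨h1, h2⟩, h3⟩
    refine ⟨h2, fun i hi hc => ?_⟩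
    rcases eq_or_ne i j with rfl | hij
    · exact h1 hc.symm
    · exact h3 i ⟨hij, hi⟩ hc
  · rintro ⟨h1, h2⟩
    exact ⟨⟨fun h => h2 j hj h.symm, h1⟩, fun i hi => h2 i hi.2⟩

/-- The graph whose edges are the pairs in `C`. -/
abbrev pairGraph (C : Finset (V × V)) : SimpleGraph V :=
  SimpleGraph.fromRel fun u v => (u, v) ∈ C

/-- A path in `C` from `a` to `b` closes up with the edge `ab` to a cycle. The cycle relation
rewrites the product over the path as `X a b` times the sum of products with one path edge omitted,
so `∏ C` becomes a combination of elements assumed to lie in `N`. -/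
theorem IsGraphOrlikTerao.prod_mul_mem [DecidableEq V] (hX : IsGraphOrlikTerao G X)
    {C : Finset (V × V)} (hC : ∀ e ∈ C, G.Adj e.1 e.2) {a b : V} (hab : G.Adj a b)
    (hr : (pairGraph C).Reachable a b) (N : Submodule K U) (w : U)
    (hw : ∀ e ∈ C, (∏ c ∈ C.erase e, X c.1 c.2) * (X a b * w) ∈ N) :
    (∏ c ∈ C, X c.1 c.2) * w ∈ N := by
  obtain ⟨P, hP⟩ := hr.exists_isPath
  let v := P.getVert
  let r := P.length
  have hv : Set.InjOn v {i | i ≤ r} := hP.getVert_injOn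
  have hv0 : v 0 = a := P.getVert_zero
  have hvr : v r = b := P.getVert_length
  have hr0 : 0 < r := by
    refine Nat.pos_of_ne_zero fun h => hab.ne ?_
    rw [← hv0, ← hvr, h]
  -- `C` may hold a path edge in either orientation; `s i` is the resulting sign. The values for `i
  -- ≥ r` are never used.
  have hedge : ∀ i, ∃ (e : V × V) (s : K), i < r → e ∈ C ∧ s * s = 1 ∧
      (e = (v i, v (i + 1)) ∨ e = (v (i + 1), v i)) ∧ X (v i) (v (i + 1)) = s • X e.1 e.2 := by
    intro i
    by_cases hi : i < r
    · have hadj := P.adj_getVert_succ hi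
      rw [SimpleGraph.fromRel_adj] at hadj
      rcases hadj.2 with h | h
      · exact ⟨_, 1, fun _ => ⟨h, by simp, Or.inl rfl, by simp [v]⟩⟩
      · refine ⟨_, -1, fun _ => ⟨h, by simp, Or.inr rfl, ?_⟩⟩
        rw [hX.antisymm _ _ (hC _ h).symm, neg_smul, one_smul]
    · exact ⟨(a, b), 1, fun h => absurd h hi⟩
  choose e s hes using hedge
  have hs : ∀ i ∈ Finset.range r, e i ∈ C := fun i hi => (hes i (Finset.mem_range.1 hi)).1
  have he : Set.InjOn e (Finset.range r) := by
    intro i hi j hj hij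
    rw [Finset.mem_coe, Finset.mem_range] at hi hj
    have hinj : ∀ k l, k ≤ r → l ≤ r → v k = v l → k = l := fun k l hk hl h => hv hk hl h
    rcases (hes i hi).2.2.1 with h1 | h1 <;> rcases (hes j hj).2.2.1 with h2 | h2 <;>
      rw [h1, h2, Prod.mk.injEq] at hij
    · exact hinj _ _ (by omega) (by omega) hij.1
    · have := hinj _ _ (by omega) (by omega) hij.1
      have := hinj _ _ (by omega) (by omega) hij.2
      omega
    · have := hinj _ _ (by omega) (by omega) hij.1
      have := hinj _ _ (by omega) (by omega) hij.2
      omega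
    · exact hinj _ _ (by omega) (by omega) hij.2
  have hprod : ∀ t ⊆ Finset.range r, ∏ i ∈ t, X (v i) (v (i + 1)) =
      (∏ i ∈ t, s i) • ∏ i ∈ t, X (e i).1 (e i).2 := by
    intro t ht
    rw [← Finset.prod_smul]
    exact Finset.prod_congr rfl fun i hi => (hes i (Finset.mem_range.1 (ht hi))).2.2.2
  have hprod' : ∏ i ∈ Finset.range r, X (e i).1 (e i).2 =
      (∏ i ∈ Finset.range r, s i) • ∏ i ∈ Finset.range r, X (v i) (v (i + 1)) := by
    rw [hprod _ subset_rfl, smul_smul, ← Finset.prod_mul_distrib,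
      Finset.prod_congr rfl fun i hi => (hes i (Finset.mem_range.1 hi)).2.1,
      Finset.prod_const_one, one_smul]
  rw [Finset.prod_eq_prod_sdiff_image_mul hs he, hprod', hX.cycle v r hr0 hv
    (fun i hi => by
      rcases (hes i hi).2.2.1 with h | h
      · simpa [h] using hC _ (hes i hi).1
      · simpa [h] using (hC _ (hes i hi).1).symm) (by rw [hv0, hvr]; exact hab.symm), hv0, hvr,
    mul_smul_comm, smul_mul_assoc]
  refine N.smul_mem _ ?_
  rw [Finset.mul_sum, Finset.mul_sum, Finset.sum_mul]
  refine N.sum_mem fun j hj => ?_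
  rw [hprod _ (Finset.erase_subset _ _), mul_smul_comm, mul_smul_comm, smul_mul_assoc]
  refine N.smul_mem _ ?_
  convert hw (e j) (hs j hj) using 1
  rw [Finset.prod_erase_eq_prod_sdiff_image_mul hs he _ hj]
  ring

theorem Submodule.span_singleton_sup_pow_succ_le {x : U} (hx : x ^ 2 = 0) (W : Submodule K U)
    (d : ℕ) : (Submodule.span K {x} ⊔ W) ^ (d + 1) ≤
      W ^ (d + 1) ⊔ Submodule.span K {x} * W ^ d := by
  have hS : Submodule.span K {x} * Submodule.span K {x} = ⊥ := by
    rw [Submodule.span_mul_span, Set.singleton_mul_singleton, ← sq, hx,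
      Submodule.span_zero_singleton]
  induction d with
  | zero => simp [sup_comm]
  | succ d ih =>
    rw [pow_succ]
    refine (mul_le_mul' ih le_rfl).trans ?_
    rw [Submodule.mul_sup, Submodule.sup_mul, Submodule.sup_mul]
    refine sup_le (sup_le ?_ ?_) (sup_le ?_ ?_)
    · rw [mul_comm]
      exact le_sup_right
    · rw [mul_right_comm, hS, Submodule.bot_mul]
      exact bot_le
    · rw [← pow_succ]
      exact le_sup_left
    · rw [mul_assoc, ← pow_succ]
      exact le_sup_right

/-- Here `C` is the set of edges contracted so far, with the classes of `p` connected by `C`, and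
`N` holds what is already accounted for. The hypothesis `hN` says that a contracted edge may be
traded for a factor from `L`. This generality is what lets the induction pass through contractions.
-/
theorem IsGraphOrlikTerao.exists_finset_span [DecidableEq V] (hX : IsGraphOrlikTerao G X)
    (L : List (V × V)) (hL : ∀ e ∈ L, G.Adj e.1 e.2) (C : Finset (V × V))
    (hC : ∀ e ∈ C, G.Adj e.1 e.2) (p : V → V) (hpC : ∀ e ∈ C, p e.1 = p e.2)
    (hp : ∀ u v, p u = p v → (pairGraph C).Reachable u v) (d : ℕ) (N : Submodule K U)
    (hN : ∀ e ∈ C, ∀ w ∈ labelSpan K X id L ^ (d + 1), (∏ c ∈ C.erase e, X c.1 c.2) * w ∈ N) :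
    ∃ B : Finset U, B.card ≤ nbcCount L p d ∧
      ∀ w ∈ labelSpan K X id L ^ d,
        (∏ c ∈ C, X c.1 c.2) * w ∈ N ⊔ Submodule.span K (B : Set U) := by
  classical
  induction L generalizing C p d N with
  | nil =>
    cases d with
    | zero =>
      refine ⟨{∏ c ∈ C, X c.1 c.2}, by simp [nbcCount], fun w hw => ?_⟩
      rw [pow_zero, Submodule.mem_one] at hw
      obtain ⟨k, rfl⟩ := hw
      rw [mul_comm, ← Algebra.smul_def]
      refine Submodule.smul_mem _ _ (Submodule.mem_sup_right (Submodule.subset_span ?_))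
      simp
    | succ d =>
      refine ⟨∅, by simp, fun w hw => ?_⟩
      have h0 : labelSpan K X id ([] : List (V × V)) = ⊥ := by simp [labelSpan]
      rw [h0, pow_succ, Submodule.mul_bot, Submodule.mem_bot] at hw
      simp [hw]
  | cons f L ih =>
    have hf : G.Adj f.1 f.2 := hL f (by simp)
    have hL' : ∀ e ∈ L, G.Adj e.1 e.2 := fun e he => hL e (by simp [he])
    have hmono (d) : labelSpan K X id L ^ d ≤ labelSpan K X id (f :: L) ^ d :=
      pow_le_pow_left' (labelSpan_le_cons _ _ _ _) d
    have hfW (d) {w} (hw : w ∈ labelSpan K X id (f :: L) ^ d) :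
        X f.1 f.2 * w ∈ labelSpan K X id (f :: L) ^ (d + 1) := by
      rw [pow_succ']
      exact Submodule.mul_mem_mul (Submodule.subset_span ⟨f, by simp, rfl⟩) hw
    -- A loop closes a cycle with edges of `C`, so everything already lies in `N` and no spanning
    -- element is needed.
    by_cases hpf : p f.1 = p f.2
    · refine ⟨∅, by simp, fun w hw => Submodule.mem_sup_left ?_⟩
      exact hX.prod_mul_mem hC hf (hp _ _ hpf) N w fun e he => hN e he _ (hfW d hw)
    obtain ⟨B, hB, hBw⟩ := ih hL' C hC p hpC hp d N fun e he w hw => hN e he w (hmono _ hw)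
    cases d with
    | zero =>
      refine ⟨B, by simpa [nbcCount, hpf] using hB, fun w hw => hBw w ?_⟩
      simpa using hw
    | succ d =>
      have hfC : f ∉ C := fun h => hpf (hpC f h)
      -- For the contraction, the deletion part is added to `N`: this is what omitting `f` from the
      -- enlarged product produces. The set `B` spans this part modulo `N`.
      let N' := N ⊔ (labelSpan K X id L ^ (d + 1)).map
        (LinearMap.mulLeft K (∏ c ∈ C, X c.1 c.2))
      obtain ⟨B', hB', hBw'⟩ := ih hL' (insert f C) (by simpa [hf] using hC)
        (mergeLabel p f.1 f.2)
        (by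
          intro e he
          rcases Finset.mem_insert.1 he with rfl | he
          · exact mergeLabel_left_eq_right p _ _
          · exact mergeLabel_congr p _ _ (hpC e he))
        (by
          have hle : pairGraph C ≤ pairGraph (insert f C) := by
            intro u v huv
            simp only [SimpleGraph.fromRel_adj, Finset.mem_insert] at huv ⊢
            tauto
          have hadj : (pairGraph (insert f C)).Reachable f.1 f.2 := by
            refine SimpleGraph.Adj.reachable ?_
            simp [hf.ne]
          intro u v huv
          rcases (mergeLabel_eq_iff p _ _ u v).1 huv with h | ⟨h, h'⟩ | ⟨h, h'⟩
          · exact (hp u v h).mono hle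
          · exact ((hp _ _ h).mono hle).trans (hadj.trans ((hp _ _ h').mono hle).symm)
          · exact ((hp _ _ h).mono hle).trans (hadj.symm.trans ((hp _ _ h').mono hle).symm))
        d N'
        (by
          intro e he w hw
          by_cases hef : e = f
          · subst hef
            rw [Finset.erase_insert hfC]
            exact Submodule.mem_sup_right ⟨w, hw, rfl⟩
          · have heC := (Finset.mem_insert.1 he).resolve_left hef
            rw [Finset.erase_insert_of_ne (Ne.symm hef),
              Finset.prod_insert fun h => hfC (Finset.mem_of_mem_erase h),
              mul_comm (X f.1 f.2), mul_assoc]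
            exact Submodule.mem_sup_left (hN e heC _ (hfW _ (hmono _ hw))))
      refine ⟨B ∪ B', ?_, fun w hw => ?_⟩
      · simp only [nbcCount, if_neg hpf]
        exact (Finset.card_union_le _ _).trans (add_le_add hB hB')
      have hBle : N ⊔ Submodule.span K (B : Set U) ≤
          N ⊔ Submodule.span K ((B ∪ B' : Finset U) : Set U) :=
        sup_le_sup_left (Submodule.span_mono (by simp)) N
      have hN' : N' ≤ N ⊔ Submodule.span K ((B ∪ B' : Finset U) : Set U) := by
        refine sup_le le_sup_left ?_
        rintro _ ⟨w, hw, rfl⟩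
        exact hBle (hBw w hw)
      rw [labelSpan_cons] at hw
      -- As `X f` squares to zero, an element of degree `d + 1` is one free of `f` plus `X f` times
      -- one free of `f`.
      obtain ⟨w₁, hw₁, w₂, hw₂, rfl⟩ := Submodule.mem_sup.1
        (Submodule.span_singleton_sup_pow_succ_le (hX.sq _ _ hf) _ _ hw)
      rw [Submodule.mem_span_singleton_mul] at hw₂
      obtain ⟨w₂, hw₂, rfl⟩ := hw₂
      rw [mul_add, ← mul_assoc, mul_comm _ (X f.1 f.2)]
      refine add_mem (hBle (hBw w₁ hw₁)) ?_
      have := hBw' w₂ hw₂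
      rw [Finset.prod_insert hfC] at this
      exact sup_le hN' (le_sup_of_le_right (Submodule.span_mono (by simp))) this

theorem IsGraphOrlikTerao.finrank_le [DecidableEq V] (hX : IsGraphOrlikTerao G X)
    (L : List (V × V)) (hL : ∀ e ∈ L, G.Adj e.1 e.2) (d : ℕ) :
    Module.finrank K ↥(labelSpan K X id L ^ d) ≤ nbcCount L id d := by
  obtain ⟨B, hB, hBw⟩ := hX.exists_finset_span (K := K) L hL ∅ (by simp) id (by simp)
    (by rintro u _ rfl; exact SimpleGraph.Reachable.refl _) d ⊥ (by simp)
  have : labelSpan K X id L ^ d ≤ Submodule.span K (B : Set U) := fun w hw => by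
    simpa using hBw w hw
  exact (Submodule.finrank_mono this).trans ((finrank_span_finset_le_card B).trans hB)

end UpperBound

/-! ### Commutativity and cycle relations of the quotient -/

namespace FominKirillov

variable (K : Type*) [Field K] {n : ℕ}

theorem x_antisymm {i j : Fin n} (h : i ≠ j) : x K h = -x K h.symm := by
  rw [x, x, ← map_neg]
  exact RingQuot.mkAlgHom_rel K (Rel.antisymm i j h)

theorem x_sq {i j : Fin n} (h : i ≠ j) : x K h ^ 2 = 0 := by
  rw [x, ← map_pow, ← map_zero (RingQuot.mkAlgHom K (Rel K n))]
  exact RingQuot.mkAlgHom_rel K (Rel.sq i j h)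

theorem x_comm {i j k l : Fin n} (hij : i ≠ j) (hik : i ≠ k) (hil : i ≠ l)
    (hjk : j ≠ k) (hjl : j ≠ l) (hkl : k ≠ l) : Commute (x K hij) (x K hkl) := by
  rw [commute_iff_eq, x, x, ← map_mul, ← map_mul]
  exact RingQuot.mkAlgHom_rel K (Rel.comm i j k l hij hik hil hjk hjl hkl)

theorem x_cyclic {i j k : Fin n} (hij : i ≠ j) (hjk : j ≠ k) (hki : k ≠ i) :
    x K hij * x K hjk + x K hjk * x K hki + x K hki * x K hij = 0 := by
  simp only [x, ← map_mul, ← map_add]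
  rw [← map_zero (RingQuot.mkAlgHom K (Rel K n))]
  exact RingQuot.mkAlgHom_rel K (Rel.cyclic i j k hij hjk hki)

/-- The generator `x_{ij}` of `E_n`, extended by `x_{ii} = 0`. -/
noncomputable def xTotal (i j : Fin n) : Alg K n :=
  if h : i ≠ j then x K h else 0

variable (G : SimpleGraph (Fin n))

open Classical in
/-- The generator `x_{ij}` of `E_G`, extended by `0` to all pairs. -/
noncomputable def edgeXTotal (i j : Fin n) : graphAlg K G :=
  if h : G.Adj i j then edgeX K h else 0

open Classical in
/-- The generator `x_{ij}` of `E_G^{ab}`, extended by `0` to all pairs. -/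
noncomputable def abXTotal (i j : Fin n) : AbAlg K G :=
  if h : G.Adj i j then abX K h else 0

variable {G}

theorem abXTotal_of_adj {i j : Fin n} (h : G.Adj i j) : abXTotal K G i j = abX K h :=
  dif_pos h

theorem coe_edgeXTotal {i j : Fin n} (h : G.Adj i j) :
    (edgeXTotal K G i j : Alg K n) = xTotal K i j := by
  simp [edgeXTotal, xTotal, h, h.ne, edgeX]

theorem mk_edgeXTotal (i j : Fin n) :
    RingQuot.mkAlgHom K (AbRel K G) (edgeXTotal K G i j) = abXTotal K G i j := by
  by_cases h : G.Adj i j <;> simp [edgeXTotal, abXTotal, h, abX]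

theorem rotationSum_xTotal (v : ℕ → Fin n) (r : ℕ) (hr : 0 < r) (hv : Set.InjOn v {i | i ≤ r}) :
    rotationSum (fun i => xTotal K (v i) (v (i + 1))) r (xTotal K (v r) (v 0)) =
      -pathProd (fun i => xTotal K (v i) (v (i + 1))) r := by
  refine rotationSum_eq_neg_pathProd (xTotal K) ?_ ?_ ?_ v r hr hv
  · intro i j h
    simpa [xTotal, h, h.symm] using x_antisymm K h
  · intro i j k l hij hik hil hjk hjl hkl
    simpa [xTotal, hij, hkl] using x_comm K hij hik hil hjk hjl hkl
  · intro i j k hij hjk hki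
    simpa [xTotal, hij, hjk, hki] using x_cyclic K hij hjk hki

theorem abX_add_swap {i j : Fin n} (h : G.Adj i j) : abX K h + abX K h.symm = 0 := by
  have : edgeX K h + edgeX K h.symm = 0 :=
    Subtype.ext (eq_neg_iff_add_eq_zero.1 (x_antisymm K h.ne))
  rw [abX, abX, ← map_add, this, map_zero]

/-- `AbAlg K G` is a ring, as an algebra over a field. -/
noncomputable instance : Ring (AbAlg K G) :=
  Algebra.semiringToRing K

theorem abX_antisymm {i j : Fin n} (h : G.Adj i j) : abX K h = -abX K h.symm :=
  eq_neg_of_add_eq_zero_left (abX_add_swap K h)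

theorem abX_sq {i j : Fin n} (h : G.Adj i j) : abX K h ^ 2 = 0 := by
  have : edgeX K h ^ 2 = 0 := Subtype.ext (x_sq K h.ne)
  rw [abX, ← map_pow, this, map_zero]

theorem abX_comm_left {i j k : Fin n} (hij : G.Adj i j) (hik : G.Adj i k) :
    Commute (abX K hij) (abX K hik) := by
  rw [commute_iff_eq, abX, abX, ← map_mul, ← map_mul]
  exact RingQuot.mkAlgHom_rel K (AbRel.comm i j k hij hik)

/-- Edges sharing a vertex commute by the imposed relations, after reorienting so that the shared
vertex comes first; disjoint edges commute already in `E_n`. -/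
theorem abX_comm {i j k l : Fin n} (hij : G.Adj i j) (hkl : G.Adj k l) :
    Commute (abX K hij) (abX K hkl) := by
  by_cases hik : i = k
  · subst hik
    exact abX_comm_left K hij hkl
  by_cases hil : i = l
  · subst hil
    rw [abX_antisymm K hkl]
    exact (abX_comm_left K hij hkl.symm).neg_right
  by_cases hjk : j = k
  · subst hjk
    rw [abX_antisymm K hij]
    exact (abX_comm_left K hij.symm hkl).neg_left
  by_cases hjl : j = l
  · subst hjl
    rw [abX_antisymm K hij, abX_antisymm K hkl]
    exact ((abX_comm_left K hij.symm hkl.symm).neg_left).neg_right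
  have : edgeX K hij * edgeX K hkl = edgeX K hkl * edgeX K hij :=
    Subtype.ext (x_comm K hij.ne hik hil hjk hjl hkl.ne)
  rw [commute_iff_eq, abX, abX, ← map_mul, ← map_mul, this]

variable (G) in
theorem adjoin_abX :
    Algebra.adjoin K {y | ∃ (i j : Fin n) (h : G.Adj i j), y = abX K h} = ⊤ := by
  have htop : Algebra.adjoin K {y : graphAlg K G | ∃ (i j : Fin n) (h : G.Adj i j),
      y = edgeX K h} = ⊤ := by
    refine Eq.trans ?_ (Algebra.adjoin_adjoin_coe_preimage
      (s := {y | ∃ (i j : Fin n) (h : G.Adj i j), y = x K h.ne}))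
    congr 1
    ext y
    simp only [Set.mem_ofPred_eq]
    constructor
    · rintro ⟨i, j, h, rfl⟩
      exact ⟨i, j, h, rfl⟩
    · rintro ⟨i, j, h, hy⟩
      exact ⟨i, j, h, Subtype.ext hy⟩
  have hmap := congrArg (Subalgebra.map (RingQuot.mkAlgHom K (AbRel K G))) htop
  rw [Algebra.map_top, (AlgHom.range_eq_top _).2 (RingQuot.mkAlgHom_surjective K (AbRel K G)),
    AlgHom.map_adjoin] at hmap
  rw [← hmap]
  congr 1
  ext y
  constructor
  · rintro ⟨i, j, h, rfl⟩
    exact ⟨_, ⟨i, j, h, rfl⟩, rfl⟩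
  · rintro ⟨_, ⟨i, j, h, rfl⟩, rfl⟩
    exact ⟨i, j, h, rfl⟩

noncomputable instance : CommRing (AbAlg K G) :=
  { (inferInstance : Ring (AbAlg K G)) with
    mul_comm := fun a b => by
      have mem (c : AbAlg K G) :
          c ∈ Algebra.adjoin K {y | ∃ (i j : Fin n) (h : G.Adj i j), y = abX K h} := by
        rw [adjoin_abX]
        exact Algebra.mem_top
      refine (Algebra.commute_of_mem_adjoin_of_forall_mem_commute (mem b) ?_).eq
      rintro _ ⟨k, l, hkl, rfl⟩
      refine (Algebra.commute_of_mem_adjoin_of_forall_mem_commute (mem a) ?_).symm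
      rintro _ ⟨i, j, hij, rfl⟩
      exact abX_comm K hkl hij }

theorem isGraphOrlikTerao_abXTotal : IsGraphOrlikTerao G (abXTotal K G) where
  antisymm u v h := by
    rw [abXTotal_of_adj K h, abXTotal_of_adj K h.symm]
    exact abX_antisymm K h
  sq u v h := by
    rw [abXTotal_of_adj K h]
    exact abX_sq K h
  cycle v r hr hv hadj hclose := by
    -- All terms involve edges of `G` only, so the relation proved in `E_n` with the help of chords
    -- holds in `E_G` and descends to the quotient.
    have h1 : rotationSum (fun i => edgeXTotal K G (v i) (v (i + 1))) r
        (edgeXTotal K G (v r) (v 0)) +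
        pathProd (fun i => edgeXTotal K G (v i) (v (i + 1))) r = 0 := by
      refine Subtype.val_injective ?_
      have h2 := eq_neg_iff_add_eq_zero.1 (rotationSum_xTotal K v r hr hv)
      rw [← coe_edgeXTotal K hclose,
        rotationSum_congr fun i hi => (coe_edgeXTotal K (hadj i hi)).symm,
        pathProd_congr fun i hi => (coe_edgeXTotal K (hadj i hi)).symm] at h2
      exact (congrArg₂ (· + ·) (map_rotationSum (graphAlg K G).val _ r _)
        (map_pathProd (graphAlg K G).val _ r)).trans h2
    have h3 := congrArg (RingQuot.mkAlgHom K (AbRel K G)) h1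
    rw [map_add, map_rotationSum, map_pathProd, map_zero] at h3
    simp only [mk_edgeXTotal] at h3
    have h4 := (rotationSum_eq (fun i => abXTotal K G (v i) (v (i + 1))) r
      (abXTotal K G (v r) (v 0))).symm.trans (eq_neg_of_add_eq_zero_left h3)
    have h5 : abXTotal K G (v 0) (v r) = -abXTotal K G (v r) (v 0) := by
      rw [abXTotal_of_adj K hclose.symm, abXTotal_of_adj K hclose]
      exact abX_antisymm K hclose.symm
    rw [h5, neg_mul, h4]
    exact ((neg_neg _).trans (pathProd_eq _ r)).symm

end FominKirillov

/-! ### Comparison with the universal algebra, the grading and the Hilbert series -/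

namespace FominKirillov

variable (K : Type*) [Field K] {n : ℕ}

/-- The homomorphism from the Fomin-Kirillov algebra to the commutative algebra with a universal
Orlik-Terao family. -/
noncomputable def toOTAlg : Alg K n →ₐ[K] OTAlg K (Fin n) :=
  RingQuot.liftAlgHom K ⟨FreeAlgebra.lift K fun p : Gen n => OTAlg.gen K p.1.1 p.1.2, by
    have h := OTAlg.isOrlikTerao_gen K (V := Fin n)
    rintro _ _ (⟨i, j, hij⟩ | ⟨i, j, hij⟩ | ⟨i, j, k, l, hij, -, -, -, -, hkl⟩ |
      ⟨i, j, k, hij, hjk, hki⟩)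
    · simpa [freeX] using h.antisymm i j
    · simpa [freeX] using h.sq i j
    · simpa [freeX] using mul_comm _ _
    · simpa [freeX] using h.cyclic i j k⟩

@[simp]
theorem toOTAlg_x {i j : Fin n} (h : i ≠ j) : toOTAlg K (x K h) = OTAlg.gen K i j := by
  rw [toOTAlg, x, RingQuot.liftAlgHom_mkAlgHom_apply, freeX, FreeAlgebra.lift_ι_apply]

variable (G : SimpleGraph (Fin n))

/-- The homomorphism from the commutative quotient of `E_G` to the commutative algebra with a
universal Orlik-Terao family. -/
noncomputable def abToOTAlg : AbAlg K G →ₐ[K] OTAlg K (Fin n) :=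
  RingQuot.liftAlgHom K ⟨(toOTAlg K).comp (graphAlg K G).val, by
    rintro _ _ ⟨i, j, k, hij, hik⟩
    rw [map_mul, map_mul, mul_comm]⟩

theorem abToOTAlg_abX {i j : Fin n} (h : G.Adj i j) :
    abToOTAlg K G (abX K h) = OTAlg.gen K i j := by
  rw [abToOTAlg, abX, RingQuot.liftAlgHom_mkAlgHom_apply]
  exact toOTAlg_x K h.ne

theorem abDegree_eq (d : ℕ) :
    abDegree K G d = labelSpan K (abXTotal K G) id G.adjList ^ d := by
  rw [abDegree, labelSpan]
  congr 2
  ext y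
  constructor
  · rintro ⟨i, j, h, rfl⟩
    exact ⟨(i, j), by simpa using h, (abXTotal_of_adj K h).symm⟩
  · rintro ⟨e, he, rfl⟩
    have h := (G.mem_adjList e).1 he
    exact ⟨e.1, e.2, h, abXTotal_of_adj K h⟩

instance (d : ℕ) : Module.Finite K (abDegree K G d) := by
  rw [abDegree_eq]
  infer_instance

theorem map_abDegree (d : ℕ) :
    (abDegree K G d).map (abToOTAlg K G).toLinearMap =
      labelSpan K (OTAlg.gen K) id G.adjList ^ d := by
  rw [abDegree_eq]
  refine map_labelSpan_pow (abToOTAlg K G) (abXTotal K G) (OTAlg.gen K) id id G.adjList d ?_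
  intro e he
  have h := (G.mem_adjList e).1 he
  exact (congrArg _ (abXTotal_of_adj K h)).trans (abToOTAlg_abX K G h)

theorem finrank_abDegree_le (d : ℕ) :
    Module.finrank K (abDegree K G d) ≤ nbcCount G.adjList id d := by
  rw [abDegree_eq]
  exact (isGraphOrlikTerao_abXTotal K).finrank_le G.adjList (fun e he => (G.mem_adjList e).1 he) d

/-- The degree `d` part has dimension at most `nbcCount`, while its image in `OTAlg` has dimension
at least `nbcCount`. -/
theorem finrank_abDegree (d : ℕ) :
    Module.finrank K (abDegree K G d) = nbcCount G.adjList id d := by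
  refine (finrank_abDegree_le K G d).antisymm ((nbcCount_le_finrank (K := K) _ _ _).trans ?_)
  rw [← map_abDegree]
  exact Submodule.finrank_map_le _ _

/-- Image and source have the same finite dimension in each degree, so the kernel there is zero. -/
theorem injOn_abToOTAlg (d : ℕ) : Set.InjOn (abToOTAlg K G) (abDegree K G d) := by
  let κ : AbAlg K G →ₗ[K] OTAlg K (Fin n) := (abToOTAlg K G).toLinearMap
  have h := finrank_add_finrank_le κ (Z := abDegree K G d)
    (Z₀ := abDegree K G d ⊓ LinearMap.ker κ) inf_le_left inf_le_right le_rfl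
  have h' := nbcCount_le_finrank (K := K) G.adjList id d
  rw [← map_abDegree, ← finrank_abDegree K G] at h'
  have h0 : Module.finrank K ↥(abDegree K G d ⊓ LinearMap.ker κ) = 0 := by
    change _ + Module.finrank K ↥((abDegree K G d).map (abToOTAlg K G).toLinearMap) ≤ _ at h
    omega
  have hfin : Module.Finite K ↥(abDegree K G d ⊓ LinearMap.ker κ) :=
    Submodule.finiteDimensional_inf_left _ _
  rw [Submodule.finrank_eq_zero] at h0
  intro a ha b hb hab
  have : a - b ∈ abDegree K G d ⊓ LinearMap.ker κ :=
    ⟨sub_mem ha hb, by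
      rw [SetLike.mem_coe, LinearMap.mem_ker, map_sub, sub_eq_zero]
      exact hab⟩
  rw [h0, Submodule.mem_bot, sub_eq_zero] at this
  exact this

theorem lift_polynomial_of_mem (L : List (Fin n × Fin n)) (d : ℕ) {a : OTAlg K (Fin n)}
    (ha : a ∈ labelSpan K (OTAlg.gen K) id L ^ d) :
    OTAlg.lift (K := K) (OTAlg.isOrlikTerao_gen K (V := Fin n)).polynomial a =
      Polynomial.C a * Polynomial.X ^ d := by
  induction d generalizing a with
  | zero =>
    rw [pow_zero, Submodule.mem_one] at ha
    obtain ⟨k, rfl⟩ := ha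
    rw [AlgHom.commutes, pow_zero, mul_one]
    rfl
  | succ d ih =>
    rw [pow_succ] at ha
    refine Submodule.mul_induction_on ha (fun a ha b hb => ?_) fun a b ha hb => ?_
    · have hb' : OTAlg.lift (K := K) (OTAlg.isOrlikTerao_gen K (V := Fin n)).polynomial b =
          Polynomial.C b * Polynomial.X := by
        refine Submodule.span_induction ?_ ?_ ?_ ?_ hb
        · rintro _ ⟨e, -, rfl⟩
          exact OTAlg.lift_gen _ _ _
        · simp
        · intro x y _ _ hx hy
          rw [map_add, hx, hy, map_add, add_mul]
        · intro k x _ hx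
          rw [map_smul, hx, ← Polynomial.smul_C, smul_mul_assoc]
      rw [map_mul, ih ha, hb', map_mul, pow_succ]
      ring
    · rw [map_add, ha, hb, map_add, add_mul]

theorem isInternal_abDegree : DirectSum.IsInternal (abDegree K G) := by
  constructor
  · have key (d : ℕ) (y : DirectSum ℕ fun d => abDegree K G d) :
        (OTAlg.lift (K := K) (OTAlg.isOrlikTerao_gen K (V := Fin n)).polynomial
          (abToOTAlg K G (DirectSum.coeAddMonoidHom (abDegree K G) y))).coeff d =
        abToOTAlg K G (y d) := by
      induction y using DirectSum.induction_on with
      | zero => simp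
      | of e u =>
        have hu : abToOTAlg K G u ∈ labelSpan K (OTAlg.gen K) id G.adjList ^ e := by
          rw [← map_abDegree]
          exact ⟨u, u.2, rfl⟩
        rw [DirectSum.coeAddMonoidHom_of, lift_polynomial_of_mem K _ _ hu,
          Polynomial.coeff_C_mul_X_pow]
        split_ifs with h
        · subst h
          rw [DirectSum.of_eq_same]
        · rw [DirectSum.of_eq_of_ne _ _ _ h]
          simp
      | add y z hy hz =>
        rw [map_add, map_add, map_add, Polynomial.coeff_add, hy, hz, DirectSum.add_apply]
        exact (map_add _ _ _).symm
    intro y z hyz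
    refine DirectSum.ext_component K fun d => Subtype.ext ?_
    refine injOn_abToOTAlg K G d (y d).2 (z d).2 ?_
    have hz := key d z
    rw [← hyz] at hz
    exact (key d y).symm.trans hz
  -- Spanning: the algebra is generated by the `abX`, and each monomial in them is homogeneous.
  · have h : Subalgebra.toSubmodule (Algebra.adjoin K
        {y | ∃ (i j : Fin n) (h : G.Adj i j), y = abX K h}) ≤
        LinearMap.range (DirectSum.coeLinearMap (abDegree K G)) := by
      rw [Algebra.adjoin_eq_span, Submodule.span_le]
      intro y hy
      have hd : ∃ d, y ∈ abDegree K G d := by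
        induction hy using Submonoid.closure_induction with
        | mem y hy => exact ⟨1, by simpa [abDegree] using Submodule.subset_span hy⟩
        | one => exact ⟨0, Submodule.one_le.1 (pow_zero _).ge⟩
        | mul y z _ _ hy hz =>
          obtain ⟨d, hy⟩ := hy
          obtain ⟨e, hz⟩ := hz
          refine ⟨d + e, ?_⟩
          rw [abDegree, pow_add]
          exact Submodule.mul_mem_mul hy hz
      obtain ⟨d, hd⟩ := hd
      exact ⟨DirectSum.lof K ℕ (fun d => abDegree K G d) d ⟨y, hd⟩,
        DirectSum.coeLinearMap_lof _ _ _⟩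
    rw [adjoin_abX] at h
    intro u
    exact h (show u ∈ (⊤ : Subalgebra K (AbAlg K G)) from Algebra.mem_top)

theorem ofPowerSeries_abHilbertSeries :
    HahnSeries.ofPowerSeries ℤ ℚ (abHilbertSeries K G) =
      (-(HahnSeries.single (1 : ℤ) (1 : ℚ) : LaurentSeries ℚ)) ^ n *
        Polynomial.aeval (-(HahnSeries.single (1 : ℤ) (1 : ℚ) : LaurentSeries ℚ)⁻¹)
          G.chromaticPolynomial := by
  have h := ofPowerSeries_mk_nbcCount G.adjList (id : Fin n → Fin n)
  rw [listChromatic_adjList, Finset.image_id, Finset.card_univ, Fintype.card_fin] at h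
  rw [← h, abHilbertSeries]
  simp only [finrank_abDegree]

end FominKirillov

theorem corollary2p7 (K : Type*) [Field K] (n : ℕ) :
    (∀ G : SimpleGraph (Fin n),
      DirectSum.IsInternal (FominKirillov.abDegree K G) ∧
      (∀ d : ℕ, Module.Finite K (FominKirillov.abDegree K G d)) ∧
      HahnSeries.ofPowerSeries ℤ ℚ (FominKirillov.abHilbertSeries K G) =
        (-(HahnSeries.single (1 : ℤ) (1 : ℚ) : LaurentSeries ℚ)) ^ n *
          Polynomial.aeval (-(HahnSeries.single (1 : ℤ) (1 : ℚ) : LaurentSeries ℚ)⁻¹)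
            G.chromaticPolynomial) ∧
    FominKirillov.abHilbertSeries K (⊤ : SimpleGraph (Fin n)) =
      ∏ k ∈ Finset.range n, (1 + (k : PowerSeries ℚ) * PowerSeries.X) := by
  refine ⟨fun G => ⟨FominKirillov.isInternal_abDegree K G, fun d => inferInstance,
    FominKirillov.ofPowerSeries_abHilbertSeries K G⟩, ?_⟩
  apply HahnSeries.ofPowerSeries_injective (Γ := ℤ) (R := ℚ)
  rw [FominKirillov.ofPowerSeries_abHilbertSeries, SimpleGraph.chromaticPolynomial_top,
    neg_pow_mul_aeval_descPochhammer (HahnSeries.single_ne_zero one_ne_zero), map_prod]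
  refine Finset.prod_congr rfl fun k _ => ?_
  rw [map_add, map_mul, map_natCast, HahnSeries.ofPowerSeries_X,
    map_one (HahnSeries.ofPowerSeries ℤ ℚ)]
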